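/- **Theorem.** A hypergraph $H=(V,E)$ consists of a non-empty finite set $V$ of vertices and a finite multiset $E$ of subsets of $V$, its edges; parallel edges are allowed, and we assume that no edge of $H$ is empty. A *walk* of length $k\ge 0$ in a hypergraph is an alternating sequence $v_0e_1v_1\ldots e_kv_k$ of vertices and edges with $v_{i-1}\ne v_i$ and $v_{i-1},v_i\in e_i$ for all $i$; its *anchors* are $v_0,\dots,v_k$. A *closed trail* is a walk with $v_0=v_k$, $k\ge 2$ and $e_1,\dots,e_k$ pairwise distinct (as members of the multiset). A *spanning Euler family* of a hypergraph is a set of closed trails, pairwise sharing no edge and no anchor, that jointly traverse every edge and such that every vertex is an anchor of exactly one of them. A hypergraph is *connected* if any two of its vertices are joined by a walk, and its *connected components* are its maximal connected subhypergraphs without empty edges, where a *subhypergraph* of $(V,E)$ is a hypergraph with a vertex set $V'\subseteq V$ whose edges are the sets $e\cap V'$, with $e$ in some submultiset of $E$. For $A\subsetneq V$, $H\backslash A$ is obtained by deleting the vertices of $A$ from $V$ and from every edge, and then deleting all empty edges; $H\backslash x$ means $H\backslash\{x\}$. Let $S=\{u,v\}\subsetneq V$ with $u\neq v$ be a 2-vertex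 cut of $H$, that is, $H\backslash S$ is not connected, and assume that the number of edges $e\in E$ (counted with multiplicity) with $e=S$ is even. Let $H_1,\dots,H_k$ be the connected components of $H\backslash S$. For each $i$, let $H_i'$ be the hypergraph with vertex set $V(H_i)\cup S$ whose edges are all the edges of $H$ contained in $V(H_i)\cup S$, and let $H_i^\ast$ be obtained from $H_i'$ by adjoining one additional copy of the edge $S$. Then $H$ admits a spanning Euler family if and only if there exists a subset $I\subseteq\{1,\dots,k\}$ of even size (possibly empty) such that 1. $H_i^\ast$ admits a spanning Euler family for each $i\in I$; 2. for each $i\in\{1,\dots,k\}\setminus I$, at least one of $H_i$, $H_i'$, $H_i'\backslash u$ and $H_i'\backslash v$ admits a spanning Euler family; and 3. if $I=\emptyset$, then at least one of the following holds: (a) $H_i'$ admits a spanning Euler family for some $i$; (b) $H_i'\backslash u$ and $H_j'\backslash v$ admit spanning Euler families for some $i\ne j$. -/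

import Mathlib

/-- A finite hypergraph with vertices in `α` and edge labels in `β`.  The multiset of edges is
represented as a finite family: the label `e ∈ edges` stands for the (copy of an) edge whose set of
vertices is `inc e`.  Labels that are not edges carry the empty set, so that a hypergraph is
determined by its vertices, its labels and the vertex sets of its edges.  An empty vertex set is
permitted only to make the operations below total. -/
@[ext]
structure MultiHypergraph (α β : Type*) where
  verts : Finset α
  edges : Finset β
  inc : β → Finset α
  inc_subset : ∀ e, inc e ⊆ verts
  inc_eq_empty : ∀ e, e ∉ edges → inc e = ∅

namespace MultiHypergraph

variable {α β : Type*}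

/-- `a` and `b` are distinct and both belong to the edge `e` of `H`. -/
def AdjVia (H : MultiHypergraph α β) (e : β) (a b : α) : Prop :=
  a ≠ b ∧ e ∈ H.edges ∧ a ∈ H.inc e ∧ b ∈ H.inc e

/-- A walk `v₀ e₁ v₁ … e_k v_k`, where `k = len`; the edge `edge i` joins `vert i` to
`vert (i + 1)`. -/
structure Walk (H : MultiHypergraph α β) where
  len : ℕ
  vert : Fin (len + 1) → α
  edge : Fin len → β
  vert_mem : ∀ i, vert i ∈ H.verts
  adj : ∀ i : Fin len, H.AdjVia (edge i) (vert i.castSucc) (vert i.succ)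

namespace Walk

variable {H : MultiHypergraph α β}

/-- The set of anchors of a walk. -/
def anchors (W : H.Walk) : Set α := Set.range W.vert

/-- The set of edges traversed by a walk. -/
def edgeSet (W : H.Walk) : Set β := Set.range W.edge

/-- A walk is closed if its endpoints agree and its length is at least two. -/
def IsClosed (W : H.Walk) : Prop := W.vert 0 = W.vert (Fin.last W.len) ∧ 2 ≤ W.len

/-- A (strict) trail: the edges are pairwise distinct. -/
def IsTrail (W : H.Walk) : Prop := Function.Injective W.edge

end Walk

/-- A set of pairwise edge-disjoint and anchor-disjoint closed trails that jointly traverse every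
edge. -/
def IsEulerFamily (H : MultiHypergraph α β) (F : Set H.Walk) : Prop :=
  (∀ T ∈ F, T.IsClosed ∧ T.IsTrail) ∧
  (∀ T ∈ F, ∀ T' ∈ F, T ≠ T' → Disjoint T.edgeSet T'.edgeSet ∧ Disjoint T.anchors T'.anchors) ∧
  (∀ e ∈ H.edges, ∃ T ∈ F, e ∈ T.edgeSet)

/-- An Euler family such that every vertex is an anchor of exactly one of its trails. -/
def IsSpanningEulerFamily (H : MultiHypergraph α β) (F : Set H.Walk) : Prop :=
  H.IsEulerFamily F ∧ ∀ a ∈ H.verts, ∃! T : H.Walk, T ∈ F ∧ a ∈ T.anchors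

/-- `H` admits a spanning Euler family. -/
def HasSpanningEulerFamily (H : MultiHypergraph α β) : Prop :=
  ∃ F : Set H.Walk, H.IsSpanningEulerFamily F

/-- `H` has no empty edges. -/
def NoEmptyEdges (H : MultiHypergraph α β) : Prop := ∀ e ∈ H.edges, (H.inc e).Nonempty

/-- Any two vertices are joined by a walk. -/
def Connected (H : MultiHypergraph α β) : Prop :=
  ∀ a ∈ H.verts, ∀ b ∈ H.verts,
    ∃ W : H.Walk, W.vert 0 = a ∧ W.vert (Fin.last W.len) = b

variable [DecidableEq α]

/-- `K` is a subhypergraph of `H`: its vertices are vertices of `H`, and its edges are the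
intersections with `V(K)` of a submultiset of the edges of `H`. -/
def IsSubhypergraph (K H : MultiHypergraph α β) : Prop :=
  K.verts ⊆ H.verts ∧ K.edges ⊆ H.edges ∧ ∀ e ∈ K.edges, K.inc e = H.inc e ∩ K.verts

/-- The subhypergraph of `H` induced by `A`: vertices outside `A` are deleted from the vertex set and
from every edge, and then the empty edges are deleted. -/
def induce (H : MultiHypergraph α β) (A : Finset α) : MultiHypergraph α β where
  verts := H.verts ∩ A
  edges := H.edges.filter fun e => (H.inc e ∩ A).Nonempty
  inc e := H.inc e ∩ A
  inc_subset e := Finset.inter_subset_inter_right (H.inc_subset e)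
  inc_eq_empty e he := by
    by_cases h : e ∈ H.edges
    · simpa [h, Finset.not_nonempty_iff_eq_empty] using he
    · simp [H.inc_eq_empty e h]

/-- `H \ A`, the subhypergraph induced by the complement of `A`. -/
def delete (H : MultiHypergraph α β) (A : Finset α) : MultiHypergraph α β :=
  H.induce (H.verts \ A)

/-- A vertex cut: a proper subset of the vertices whose deletion leaves a disconnected
hypergraph. -/
def IsVertexCut (H : MultiHypergraph α β) (S : Finset α) : Prop :=
  S ⊂ H.verts ∧ ¬ (H.delete S).Connected

/-- The connected components of `H` are its maximal (with respect to being a subhypergraph)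
connected subhypergraphs without empty edges. -/
def IsComponent (H K : MultiHypergraph α β) : Prop :=
  (K.verts.Nonempty ∧ K.IsSubhypergraph H ∧ K.Connected ∧ K.NoEmptyEdges) ∧
  ∀ L : MultiHypergraph α β,
    L.verts.Nonempty → L.IsSubhypergraph H → L.Connected → L.NoEmptyEdges →
      K.IsSubhypergraph L → L = K

variable [DecidableEq β]

/-- The `S`-component of `H` corresponding to a component `K` of `H \ S`: its vertex set is
`V(K) ∪ S`, and its edges are the nonempty edges of `H` contained in `V(K) ∪ S`. -/
def sComponent (H : MultiHypergraph α β) (S : Finset α) (K : MultiHypergraph α β) :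
    MultiHypergraph α β where
  verts := K.verts ∪ S
  edges := H.edges.filter fun e => H.inc e ⊆ K.verts ∪ S ∧ H.inc e ≠ ∅
  inc e := if e ∈ H.edges ∧ H.inc e ⊆ K.verts ∪ S ∧ H.inc e ≠ ∅ then H.inc e else ∅
  inc_subset e := by
    split_ifs with h
    · exact h.2.1
    · exact Finset.empty_subset _
  inc_eq_empty e he := by
    rw [Finset.mem_filter] at he
    exact if_neg he

/-- The `S*`-component of `H` (for `|S|` even) corresponding to a component `K` of `H \ S`: the
`S`-component together with `|S| / 2` new copies of the edge `S`. -/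
def sStarComponent (H : MultiHypergraph α β) (S : Finset α) (K : MultiHypergraph α β) :
    MultiHypergraph α (β ⊕ Fin (S.card / 2)) where
  verts := (H.sComponent S K).verts
  edges := (H.sComponent S K).edges.disjSum Finset.univ
  inc := Sum.elim (H.sComponent S K).inc fun _ => S
  inc_subset e := by
    rcases e with e | j
    · exact (H.sComponent S K).inc_subset e
    · exact Finset.subset_union_right
  inc_eq_empty e he := by
    rcases e with e | j
    · exact (H.sComponent S K).inc_eq_empty e (by simpa using he)
    · simp at he

end MultiHypergraph

/-! A spanning Euler family amounts to choosing two vertices of every edge so that every vertex is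
chosen a positive even number of times (`hasSpanningEulerFamily_iff`): each edge chooses the anchors
between which it is traversed, and conversely a choice is a graph with positive even degrees, which
splits into closed trails.

Such choices can be made piece by piece. Every edge either meets exactly one component of `H \ S` or
lies inside `S`. A vertex of a component sees only the edges of that component, while the degree of
`u` or `v` is a sum over all components plus the number m of edges inside `S`, each of which must
equal `S` and choose both vertices (`hasSpanningEulerFamily_iff_pieces`). So each hypergraph in the
statement is described by the possible degrees of `u` and `v` within one component: both odd for
`H_i*` (as m is even), both zero for `H_i`, zero at `u` and positive even at `v` for `H_i' \ u`, and
symmetrically for `H_i' \ v`. For `H_i'` both become positive even after adding m.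

By the handshake lemma the degrees of `u` and `v` in one component have the same parity
(`IsPieceSelection.even_sum`). The set `I` records the components where they are odd; its size is
even because the totals are. What remains is positivity of the totals at `u` and `v`: it is
automatic when `I` is nonempty, and condition 3 provides it otherwise. -/

namespace MultiHypergraph

/-! ### Spanning Euler families as even selections of two vertices per edge. -/

section Selection

variable {α β : Type*} [DecidableEq α]

/-- The number of edges `e ∈ E` such that `p e` contains `a`. -/
def selDegree (E : Finset β) (p : β → Finset α) (a : α) : ℕ := (E.filter fun e => a ∈ p e).card

/-- `p` selects two vertices of every edge of `H`, and every vertex of `H` is selected by a positive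
even number of edges. -/
def IsEvenSelection (H : MultiHypergraph α β) (p : β → Finset α) : Prop :=
  (∀ e ∈ H.edges, p e ⊆ H.inc e ∧ (p e).card = 2) ∧
  ∀ a ∈ H.verts, Even (selDegree H.edges p a) ∧ 0 < selDegree H.edges p a

/-- A closed walk leaves a vertex as often as it enters it: counting visits over all positions,
split off the first position or the last. -/
theorem card_castSucc_eq_card_succ {n : ℕ} (f : Fin (n + 1) → α) (hf : f 0 = f (Fin.last n))
    (a : α) :
    (Finset.univ.filter fun i : Fin n => f i.castSucc = a).card =
      (Finset.univ.filter fun i : Fin n => f i.succ = a).card := by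
  have h1 := Fin.sum_univ_succ fun i => if f i = a then 1 else 0
  have h2 := Fin.sum_univ_castSucc fun i => if f i = a then 1 else 0
  rw [h1, hf] at h2
  rw [Finset.card_filter, Finset.card_filter]
  omega

/-- Each edge selects the two ends of its unique traversal. Only one trail visits `a`, so the degree
of `a` counts its departures and arrivals, which are equal in number. -/
theorem HasSpanningEulerFamily.exists_isEvenSelection {H : MultiHypergraph α β}
    (h : H.HasSpanningEulerFamily) : ∃ p, H.IsEvenSelection p := by
  classical
  obtain ⟨F, ⟨hcl, hdisj, hcov⟩, hspan⟩ := h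
  have hex : ∀ e : β, ∃ q : Finset α, e ∈ H.edges → ∃ T ∈ F, ∃ i, T.edge i = e ∧
      q = {T.vert i.castSucc, T.vert i.succ} := by
    intro e
    by_cases he : e ∈ H.edges
    · obtain ⟨T, hT, i, hi⟩ := hcov e he
      exact ⟨_, fun _ => ⟨T, hT, i, hi, rfl⟩⟩
    · exact ⟨∅, fun h => absurd h he⟩
  choose p hp using hex
  refine ⟨p, fun e he => ?_, fun a ha => ?_⟩
  · obtain ⟨T, hT, i, rfl, hq⟩ := hp e he
    obtain ⟨hne, -, h1, h2⟩ := T.adj i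
    rw [hq]
    refine ⟨?_, Finset.card_pair hne⟩
    intro x hx
    simp only [Finset.mem_insert, Finset.mem_singleton] at hx
    rcases hx with rfl | rfl <;> assumption
  · obtain ⟨T, ⟨hT, j, hj⟩, huniq⟩ := hspan a ha
    have heq : (H.edges.filter fun e => a ∈ p e) =
        (Finset.univ.filter fun i : Fin T.len =>
          T.vert i.castSucc = a ∨ T.vert i.succ = a).image T.edge := by
      ext e
      simp only [Finset.mem_filter, Finset.mem_image, Finset.mem_univ, true_and]
      constructor
      · rintro ⟨he, hae⟩
        obtain ⟨T', hT', i, rfl, hq⟩ := hp e he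
        simp only [hq, Finset.mem_insert, Finset.mem_singleton] at hae
        have : T' = T := by
          refine huniq T' ⟨hT', ?_⟩
          rcases hae with h | h
          · exact ⟨_, h.symm⟩
          · exact ⟨_, h.symm⟩
        subst this
        exact ⟨i, hae.imp Eq.symm Eq.symm, rfl⟩
      · rintro ⟨i, hi, rfl⟩
        have he := (T.adj i).2.1
        refine ⟨he, ?_⟩
        obtain ⟨T', hT', i', hi', hq⟩ := hp _ he
        have : T' = T := by
          by_contra hne
          exact Set.disjoint_left.1 (hdisj T' hT' T hT hne).1 ⟨i', hi'⟩ ⟨i, rfl⟩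
        subst this
        have := (hcl T' hT).2 hi'
        subst this
        simp only [hq, Finset.mem_insert, Finset.mem_singleton]
        exact hi.imp Eq.symm Eq.symm
    have hcs := card_castSucc_eq_card_succ T.vert (hcl T hT).1.1 a
    have hcard : selDegree H.edges p a =
        (Finset.univ.filter fun i : Fin T.len => T.vert i.succ = a).card +
        (Finset.univ.filter fun i : Fin T.len => T.vert i.succ = a).card := by
      rw [selDegree, heq, Finset.card_image_of_injective _ (hcl T hT).2, Finset.filter_or,
        Finset.card_union_of_disjoint, hcs]
      rw [Finset.disjoint_filter]
      intro i _ h1 h2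
      exact (T.adj i).1 (h1.trans h2.symm)
    rw [hcard]
    refine ⟨⟨_, rfl⟩, ?_⟩
    suffices 0 < (Finset.univ.filter fun i : Fin T.len => T.vert i.succ = a).card by omega
    obtain ⟨h0, hlen⟩ := (hcl T hT).1
    rw [Finset.card_pos]
    -- A visit at position 0 is not an arrival; since the trail is closed, it is replaced by the
    -- visit at the last position.
    induction j using Fin.cases with
    | zero =>
      obtain ⟨n, hn⟩ : ∃ n, T.len = n + 1 := ⟨T.len - 1, by omega⟩
      refine ⟨⟨n, by omega⟩, ?_⟩
      simp only [Finset.mem_filter, Finset.mem_univ, true_and]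
      rw [← hj, h0]
      congr 1
      ext
      simp [hn]
    | succ i => exact ⟨i, by simpa using hj⟩

/-- `l = [(e₁, x₁), …, (e_n, x_n)]` describes a walk `x e₁ x₁ … e_n x_n` with `x_n = y`, whose edges
belong to `E` and in which the endpoints of each edge are its selected vertices. -/
def IsTrace (E : Finset β) (p : β → Finset α) : α → List (β × α) → α → Prop
  | x, [], y => x = y
  | x, d :: l, y => (d.1 ∈ E ∧ x ≠ d.2 ∧ p d.1 = {x, d.2}) ∧ IsTrace E p d.2 l y

variable {E : Finset β} {p : β → Finset α}

theorem isTrace_append {x y : α} {l₁ l₂ : List (β × α)} :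
    IsTrace E p x (l₁ ++ l₂) y ↔ ∃ z, IsTrace E p x l₁ z ∧ IsTrace E p z l₂ y := by
  induction l₁ generalizing x with
  | nil => simp [IsTrace]
  | cons d l ih => simp [IsTrace, ih, and_assoc]

theorem IsTrace.mem {x y : α} {l : List (β × α)} (h : IsTrace E p x l y) :
    ∀ e ∈ l.map Prod.fst, e ∈ E := by
  induction l generalizing x with
  | nil => simp
  | cons d l ih =>
    obtain ⟨⟨hd, -⟩, h⟩ := h
    simpa [hd] using ih h

theorem IsTrace.sel_subset {x y : α} {l : List (β × α)} (h : IsTrace E p x l y) {e : β}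
    (he : e ∈ l.map Prod.fst) {b : α} (hb : b ∈ p e) : b ∈ x :: l.map Prod.snd := by
  induction l generalizing x with
  | nil => simp at he
  | cons d l ih =>
    obtain ⟨⟨-, -, hd⟩, h⟩ := h
    rw [List.map_cons, List.mem_cons] at he
    rcases he with rfl | he
    · rw [hd] at hb
      simp only [Finset.mem_insert, Finset.mem_singleton] at hb
      rcases hb with rfl | rfl <;> simp
    · exact List.mem_cons_of_mem _ (ih h he)

theorem IsTrace.split {x y b : α} {l : List (β × α)} (h : IsTrace E p x l y)
    (hb : b ∈ x :: l.map Prod.snd) :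
    ∃ l₁ l₂, l = l₁ ++ l₂ ∧ IsTrace E p x l₁ b ∧ IsTrace E p b l₂ y := by
  induction l generalizing x with
  | nil =>
    have : b = x := by simpa using hb
    subst this
    exact ⟨[], [], rfl, rfl, h⟩
  | cons d l ih =>
    rcases List.mem_cons.1 hb with rfl | hb
    · exact ⟨[], _, rfl, rfl, h⟩
    · obtain ⟨l₁, l₂, rfl, h1, h2⟩ := ih h.2 hb
      exact ⟨d :: l₁, l₂, rfl, ⟨h.1, h1⟩, h2⟩

/-- Passing through a vertex uses two edges, so only the ends of an open trail have odd degree in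
it. -/
theorem IsTrace.even_selDegree [DecidableEq β] {x y : α} {l : List (β × α)}
    (h : IsTrace E p x l y) (hl : (l.map Prod.fst).Nodup) (a : α) :
    Even (selDegree (l.map Prod.fst).toFinset p a + (if x = a then 1 else 0) +
      (if y = a then 1 else 0)) := by
  induction l generalizing x with
  | nil =>
    obtain rfl : x = y := h
    simp only [selDegree, List.map_nil, List.toFinset_nil, Finset.filter_empty, Finset.card_empty]
    exact ⟨if x = a then 1 else 0, by omega⟩
  | cons d l ih =>
    obtain ⟨⟨-, hne, hd⟩, h⟩ := h
    rw [List.map_cons, List.nodup_cons] at hl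
    have := ih h hl.2
    rw [selDegree] at this ⊢
    rw [List.map_cons, List.toFinset_cons, Finset.filter_insert]
    simp only [hd, Finset.mem_insert, Finset.mem_singleton]
    have hn : d.1 ∉ (l.map Prod.fst).toFinset.filter fun e => a ∈ p e := by
      simp only [Finset.mem_filter, List.mem_toFinset]
      exact fun h => hl.1 h.1
    by_cases h1 : x = a
    · have h2 : d.2 ≠ a := fun h => hne (h1.trans h.symm)
      rw [if_pos (Or.inl h1.symm), Finset.card_insert_of_notMem hn]
      simp only [h1, h2, if_true, if_false] at this ⊢
      grind
    · by_cases h2 : d.2 = a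
      · rw [if_pos (Or.inr h2.symm), Finset.card_insert_of_notMem hn]
        simp only [h1, h2, if_true, if_false] at this ⊢
        grind
      · rw [if_neg (by rintro (h | h) <;> simp_all)]
        simp only [h1, h2, if_false] at this ⊢
        exact this

/-- A longest trail through `e₀` has used every edge at its final vertex. As all degrees are even it
is closed, and then it can be rotated to end at any of its anchors. -/
theorem exists_saturated_trace (hE : ∀ e ∈ E, (p e).card = 2) (heven : ∀ a, Even (selDegree E p a))
    {e₀ : β} (he₀ : e₀ ∈ E) :
    ∃ x l, IsTrace E p x l x ∧ (l.map Prod.fst).Nodup ∧ e₀ ∈ l.map Prod.fst ∧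
      ∀ e ∈ E, ∀ b ∈ x :: l.map Prod.snd, b ∈ p e → e ∈ l.map Prod.fst := by
  classical
  let P : ℕ → Prop := fun n => ∃ x l y, IsTrace E p x l y ∧ (l.map Prod.fst).Nodup ∧
    e₀ ∈ l.map Prod.fst ∧ l.length = n
  have hbound : ∀ n, P n → n ≤ E.card := by
    rintro n ⟨x, l, y, h, hnd, -, rfl⟩
    rw [← List.length_map (f := Prod.fst), ← List.toFinset_card_of_nodup hnd]
    exact Finset.card_le_card fun e he => h.mem e (by simpa using he)
  have hother : ∀ e ∈ E, ∀ b ∈ p e, ∃ c, b ≠ c ∧ p e = {b, c} := by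
    intro e he b hb
    obtain ⟨c, d, hcd, h⟩ := Finset.card_eq_two.1 (hE e he)
    rw [h] at hb
    simp only [Finset.mem_insert, Finset.mem_singleton] at hb
    rcases hb with rfl | rfl
    · exact ⟨d, hcd, h⟩
    · exact ⟨c, hcd.symm, by rw [h, Finset.pair_comm]⟩
  have h1 : P 1 := by
    obtain ⟨c, d, hcd, h⟩ := Finset.card_eq_two.1 (hE e₀ he₀)
    exact ⟨c, [(e₀, d)], d, ⟨⟨he₀, hcd, h⟩, rfl⟩, by simp, by simp, rfl⟩
  have hmax := Nat.findGreatest_spec (hbound 1 h1) h1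
  have hext : ∀ x l y, IsTrace E p x l y → (l.map Prod.fst).Nodup → e₀ ∈ l.map Prod.fst →
      l.length = Nat.findGreatest P E.card → ∀ e ∈ E, y ∈ p e → e ∈ l.map Prod.fst := by
    intro x l y h hnd he hlen e heE hy
    by_contra hel
    obtain ⟨c, hc, hpe⟩ := hother e heE y hy
    have hP : P (l.length + 1) := by
      refine ⟨x, l ++ [(e, c)], c, isTrace_append.2 ⟨y, h, ⟨heE, hc, hpe⟩, rfl⟩, ?_, ?_, by simp⟩
      · rw [List.map_append, List.nodup_append]
        refine ⟨hnd, by simp, ?_⟩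
        intro a ha b hb
        have : b = e := by simpa using hb
        subst this
        rintro rfl
        exact hel ha
      · rw [List.map_append]
        exact List.mem_append_left _ he
    have := Nat.le_findGreatest (hbound _ hP) hP
    omega
  obtain ⟨x, l, y, h, hnd, he, hlen⟩ := hmax
  -- Otherwise the trail has odd degree at `y`, yet it contains all the edges selecting `y`, which
  -- are even in number.
  have hxy : x = y := by
    by_contra hxy
    have hpar := h.even_selDegree hnd y
    rw [if_neg hxy, if_pos rfl] at hpar
    have : (l.map Prod.fst).toFinset.filter (fun e => y ∈ p e) = E.filter fun e => y ∈ p e := by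
      ext e
      simp only [Finset.mem_filter, List.mem_toFinset]
      exact ⟨fun ⟨h1, h2⟩ => ⟨h.mem e h1, h2⟩,
        fun ⟨h1, h2⟩ => ⟨hext x l y h hnd he hlen e h1 h2, h2⟩⟩
    have h2 := heven y
    rw [selDegree, this] at hpar
    rw [selDegree] at h2
    grind
  subst hxy
  refine ⟨x, l, h, hnd, he, fun e heE b hb hbe => ?_⟩
  obtain ⟨l₁, l₂, rfl, ha, hb⟩ := h.split hb
  -- The rotated trail starts and ends at `b` and is equally long, so `hext` applies to it at `b`.
  have hperm : (l₂ ++ l₁).Perm (l₁ ++ l₂) := List.perm_append_comm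
  have hperm' := hperm.map Prod.fst
  exact hperm'.mem_iff.1 (hext b (l₂ ++ l₁) b (isTrace_append.2 ⟨x, hb, ha⟩)
    (hperm'.nodup_iff.2 hnd) (hperm'.mem_iff.2 he) (by rw [hperm.length_eq, hlen]) e heE hbe)

theorem IsTrace.step {x y : α} {l : List (β × α)} (h : IsTrace E p x l y) (i : ℕ)
    (hi : i < l.length) :
    l[i].1 ∈ E ∧ (x :: l.map Prod.snd)[i]'(by simp; omega) ≠ (x :: l.map Prod.snd)[i + 1]'(by simpa) ∧
      p l[i].1 = {(x :: l.map Prod.snd)[i]'(by simp; omega),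
        (x :: l.map Prod.snd)[i + 1]'(by simpa)} := by
  induction l generalizing x i with
  | nil => simp at hi
  | cons d l ih =>
    cases i with
    | zero => simpa using h.1
    | succ i => simpa using ih h.2 i (by simpa using hi)

theorem IsTrace.getElem_length {x y : α} {l : List (β × α)} (h : IsTrace E p x l y) :
    (x :: l.map Prod.snd)[l.length]'(by simp) = y := by
  induction l generalizing x with
  | nil => exact h
  | cons d l ih => simpa using ih h.2

theorem IsEvenSelection.even {H : MultiHypergraph α β} (h : H.IsEvenSelection p) (a : α) :
    Even (selDegree H.edges p a) := by
  by_cases ha : a ∈ H.verts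
  · exact (h.2 a ha).1
  · have : selDegree H.edges p a = 0 := by
      rw [selDegree, Finset.card_eq_zero, Finset.filter_eq_empty_iff]
      exact fun e he hae => ha (H.inc_subset e ((h.1 e he).1 hae))
    simp [this]

/-- A closed trail that joins the selected vertices of its edges and is not incident with any
further edge. -/
structure IsSaturated (H : MultiHypergraph α β) (p : β → Finset α) (W : H.Walk) : Prop where
  closed : W.IsClosed
  trail : W.IsTrail
  sel : ∀ i, p (W.edge i) = {W.vert i.castSucc, W.vert i.succ}
  sat : ∀ e ∈ H.edges, ∀ b ∈ W.anchors, b ∈ p e → e ∈ W.edgeSet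

theorem IsSaturated.sel_subset {H : MultiHypergraph α β} {W : H.Walk} (h : H.IsSaturated p W)
    {e : β} (he : e ∈ W.edgeSet) {b : α} (hb : b ∈ p e) : b ∈ W.anchors := by
  obtain ⟨i, rfl⟩ := he
  rw [h.sel] at hb
  simp only [Finset.mem_insert, Finset.mem_singleton] at hb
  rcases hb with rfl | rfl <;> exact ⟨_, rfl⟩

/-- Each edge of `W` has both ends among the anchors of `W'` or neither, so one common anchor
carries all of `W` into `W'`. -/
theorem IsSaturated.edgeSet_subset {H : MultiHypergraph α β} {W W' : H.Walk}
    (h : H.IsSaturated p W) (h' : H.IsSaturated p W') {b : α} (hb : b ∈ W.anchors)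
    (hb' : b ∈ W'.anchors) : W.edgeSet ⊆ W'.edgeSet := by
  have hstep : ∀ i : Fin W.len, W.vert i.castSucc ∈ W'.anchors ↔ W.vert i.succ ∈ W'.anchors := by
    intro i
    have he := (W.adj i).2.1
    have hs := h.sel i
    constructor
    · intro hv
      exact h'.sel_subset (h'.sat _ he _ hv (by simp [hs])) (by simp [hs])
    · intro hv
      exact h'.sel_subset (h'.sat _ he _ hv (by simp [hs])) (by simp [hs])
  have hall : ∀ j, W.vert j ∈ W'.anchors ↔ W.vert 0 ∈ W'.anchors := by
    intro j
    induction j using Fin.induction with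
    | zero => rfl
    | succ i ih => rw [← hstep, ih]
  obtain ⟨j, rfl⟩ := hb
  rintro e ⟨i, rfl⟩
  exact h'.sat _ (W.adj i).2.1 (W.vert i.castSucc) ((hall _).2 ((hall j).1 hb')) (by simp [h.sel])

theorem IsSaturated.edgeSet_eq {H : MultiHypergraph α β} {W W' : H.Walk}
    (h : H.IsSaturated p W) (h' : H.IsSaturated p W') {b : α} (hb : b ∈ W.anchors)
    (hb' : b ∈ W'.anchors) : W.edgeSet = W'.edgeSet :=
  (h.edgeSet_subset h' hb hb').antisymm (h'.edgeSet_subset h hb' hb)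

theorem IsEvenSelection.exists_isSaturated {H : MultiHypergraph α β} (h : H.IsEvenSelection p)
    {e₀ : β} (he₀ : e₀ ∈ H.edges) : ∃ W : H.Walk, H.IsSaturated p W ∧ e₀ ∈ W.edgeSet := by
  obtain ⟨x, l, htr, hnd, hmem, hsat⟩ :=
    exists_saturated_trace (fun e he => (h.1 e he).2) h.even he₀
  have hinc : ∀ e ∈ H.edges, p e ⊆ H.inc e := fun e he => (h.1 e he).1
  have hlpos : l ≠ [] := by rintro rfl; simp at hmem
  have hanch : ∀ b ∈ x :: l.map Prod.snd, b ∈ H.verts := by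
    have hx : x ∈ H.verts := by
      cases l with
      | nil => exact absurd rfl hlpos
      | cons d l => exact H.inc_subset _ (hinc _ htr.1.1 (by simp [htr.1.2.2]))
    intro b hb
    obtain ⟨i, hi, rfl⟩ := List.getElem_of_mem hb
    cases i with
    | zero => exact hx
    | succ i =>
      have := htr.step i (by simpa using hi)
      exact H.inc_subset _ (hinc _ this.1 (by rw [this.2.2]; simp))
  let W : H.Walk :=
    { len := l.length
      vert := fun i => (x :: l.map Prod.snd)[i.val]'(by simpa using i.isLt)
      edge := fun i => l[i.val].1
      vert_mem := fun i => hanch _ (List.getElem_mem _)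
      adj := fun i => by
        have := htr.step i.val i.isLt
        exact ⟨this.2.1, this.1, hinc _ this.1 (by rw [this.2.2]; simp),
          hinc _ this.1 (by rw [this.2.2]; simp)⟩ }
  have hWe : ∀ e, e ∈ W.edgeSet ↔ e ∈ l.map Prod.fst := by
    intro e
    rw [List.mem_iff_getElem]
    constructor
    · rintro ⟨i, rfl⟩
      exact ⟨i.val, (List.length_map _).symm ▸ i.isLt, by simp [W]⟩
    · rintro ⟨i, hi, rfl⟩
      exact ⟨⟨i, by simpa using hi⟩, by simp [W]⟩
  have hclosed : W.vert 0 = W.vert (Fin.last W.len) := by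
    have := htr.getElem_length
    simpa [W] using this.symm
  refine ⟨W, ⟨⟨hclosed, ?_⟩, ?_, fun i => (htr.step i.val i.isLt).2.2, ?_⟩, (hWe _).2 hmem⟩
  · change 2 ≤ l.length
    -- A closed trace of length one would join a vertex to itself.
    match l, hlpos, htr with
    | [d], _, htr =>
      exact absurd htr.2.symm htr.1.2.1
    | _ :: _ :: l, _, _ => simp
  · intro i j hij
    have := (List.nodup_iff_injective_getElem.1 hnd) (a₁ := ⟨i.val, (List.length_map _).symm ▸ i.isLt⟩)
      (a₂ := ⟨j.val, (List.length_map _).symm ▸ j.isLt⟩) (by simpa [W] using hij)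
    simpa [Fin.ext_iff] using this
  · rintro e he b ⟨i, rfl⟩ hb
    rw [hWe]
    exact hsat e he _ (List.getElem_mem _) hb

theorem IsEvenSelection.hasSpanningEulerFamily {H : MultiHypergraph α β}
    (h : H.IsEvenSelection p) : H.HasSpanningEulerFamily := by
  -- The same trail occurs with different starting points and directions; one representative is kept
  -- for each edge set.
  obtain ⟨F, hF, hbij⟩ := Set.exists_subset_bijOn {W : H.Walk | H.IsSaturated p W} Walk.edgeSet
  have hanchor : ∀ T ∈ F, ∀ T' ∈ F, ∀ b, b ∈ T.anchors → b ∈ T'.anchors → T = T' :=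
    fun T hT T' hT' b hb hb' => hbij.injOn hT hT' ((hF hT).edgeSet_eq (hF hT') hb hb')
  have hcov : ∀ e ∈ H.edges, ∃ T ∈ F, e ∈ T.edgeSet := by
    intro e he
    obtain ⟨W, hW, heW⟩ := h.exists_isSaturated he
    obtain ⟨T, hT, hTW⟩ := hbij.surjOn ⟨W, hW, rfl⟩
    exact ⟨T, hT, hTW ▸ heW⟩
  refine ⟨F, ⟨fun T hT => ⟨(hF hT).closed, (hF hT).trail⟩, fun T hT T' hT' hne => ⟨?_, ?_⟩, hcov⟩,
    fun a ha => ?_⟩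
  · rw [Set.disjoint_left]
    rintro _ ⟨i, rfl⟩ he'
    exact hne (hanchor T hT T' hT' (T.vert i.castSucc) ⟨_, rfl⟩
      ((hF hT').sel_subset he' (by simp [(hF hT).sel])))
  · rw [Set.disjoint_left]
    exact fun b hb hb' => hne (hanchor T hT T' hT' b hb hb')
  · obtain ⟨e, he⟩ := Finset.card_pos.1 (h.2 a ha).2
    rw [Finset.mem_filter] at he
    obtain ⟨T, hT, heT⟩ := hcov e he.1
    have haT := (hF hT).sel_subset heT he.2
    exact ⟨T, ⟨hT, haT⟩, fun T' hT' => hanchor T' hT'.1 T hT a hT'.2 haT⟩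

/-- A hypergraph admits a spanning Euler family if and only if its incidence graph has an even
subgraph without isolated vertices in which the edges have degree two. -/
theorem hasSpanningEulerFamily_iff {H : MultiHypergraph α β} :
    H.HasSpanningEulerFamily ↔ ∃ p, H.IsEvenSelection p :=
  ⟨fun h => h.exists_isEvenSelection, fun ⟨_, h⟩ => h.hasSpanningEulerFamily⟩

end Selection

/-! ### Connected components as the subhypergraphs induced by reachability classes. -/

section Components

variable {α β : Type*}

/-- Some edge contains both of the distinct vertices `a` and `b`. -/
def Adj (H : MultiHypergraph α β) (a b : α) : Prop := ∃ e, H.AdjVia e a b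

theorem Adj.symm {H : MultiHypergraph α β} {a b : α} : H.Adj a b → H.Adj b a :=
  fun ⟨e, hne, he, ha, hb⟩ => ⟨e, hne.symm, he, hb, ha⟩

theorem Adj.mem_right {H : MultiHypergraph α β} {a b : α} : H.Adj a b → b ∈ H.verts :=
  fun ⟨e, _, _, _, hb⟩ => H.inc_subset e hb

theorem exists_walk_iff {H : MultiHypergraph α β} {a b : α} (ha : a ∈ H.verts) :
    (∃ W : H.Walk, W.vert 0 = a ∧ W.vert (Fin.last W.len) = b) ↔
      Relation.ReflTransGen H.Adj a b := by
  constructor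
  · rintro ⟨W, rfl, rfl⟩
    have : ∀ j, Relation.ReflTransGen H.Adj (W.vert 0) (W.vert j) := by
      intro j
      induction j using Fin.induction with
      | zero => exact .refl
      | succ i ih => exact ih.tail ⟨_, W.adj i⟩
    exact this _
  · intro h
    induction h with
    | refl => exact ⟨⟨0, fun _ => a, Fin.elim0, fun _ => ha, fun i => i.elim0⟩, rfl, rfl⟩
    | @tail b c _ hbc ih =>
      obtain ⟨W, h0, hl⟩ := ih
      have hc := hbc.mem_right
      obtain ⟨e, he⟩ := hbc
      refine ⟨⟨W.len + 1, Fin.snoc (α := fun _ => α) W.vert c, Fin.snoc (α := fun _ => β) W.edge e,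
        ?_, ?_⟩, ?_, ?_⟩
      · intro i
        induction i using Fin.lastCases with
        | last => simpa using hc
        | cast i => simpa using W.vert_mem i
      · intro i
        induction i using Fin.lastCases with
        | last => simpa [hl] using he
        | cast i => simpa only [Fin.snoc_castSucc, Fin.succ_castSucc] using W.adj i
      · rw [← h0]
        exact Fin.snoc_castSucc (α := fun _ => α) c W.vert 0
      · exact Fin.snoc_last (α := fun _ => α) c W.vert

open Classical in
/-- The set of vertices that can be reached from `a`. -/
noncomputable def reach (H : MultiHypergraph α β) (a : α) : Finset α :=
  H.verts.filter fun b => Relation.ReflTransGen H.Adj a b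

theorem mem_reach {H : MultiHypergraph α β} {a b : α} :
    b ∈ H.reach a ↔ b ∈ H.verts ∧ Relation.ReflTransGen H.Adj a b := by
  classical
  simp [reach]

theorem mem_reach_self {H : MultiHypergraph α β} {a : α} (ha : a ∈ H.verts) : a ∈ H.reach a :=
  mem_reach.2 ⟨ha, .refl⟩

theorem mem_reach_of_mem_inc {H : MultiHypergraph α β} {a b c : α} {e : β} (he : e ∈ H.edges)
    (hb : b ∈ H.inc e) (hc : c ∈ H.inc e) (h : b ∈ H.reach a) : c ∈ H.reach a := by
  by_cases hbc : b = c
  · exact hbc ▸ h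
  · exact mem_reach.2 ⟨H.inc_subset e hc, (mem_reach.1 h).2.tail ⟨e, hbc, he, hb, hc⟩⟩

variable [DecidableEq α]

theorem induce_reach_connected (H : MultiHypergraph α β) {a : α} (ha : a ∈ H.verts) :
    (H.induce (H.reach a)).Connected := by
  have key : ∀ b, Relation.ReflTransGen H.Adj a b →
      b ∈ H.reach a ∧ Relation.ReflTransGen (H.induce (H.reach a)).Adj a b := by
    intro b h
    induction h with
    | refl => exact ⟨mem_reach_self ha, .refl⟩
    | tail _ hbc ih =>
      obtain ⟨e, hne, he, hb, hc⟩ := hbc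
      have hc' := mem_reach_of_mem_inc he hb hc ih.1
      exact ⟨hc', ih.2.tail ⟨e, hne, Finset.mem_filter.2 ⟨he, _, Finset.mem_inter.2 ⟨hb, ih.1⟩⟩,
        Finset.mem_inter.2 ⟨hb, ih.1⟩, Finset.mem_inter.2 ⟨hc, hc'⟩⟩⟩
  intro b hb c hc
  rw [exists_walk_iff hb]
  have hb' := (key b (mem_reach.1 (Finset.mem_inter.1 hb).2).2).2
  have hc' := (key c (mem_reach.1 (Finset.mem_inter.1 hc).2).2).2
  have : Std.Symm (H.induce (H.reach a)).Adj := ⟨fun _ _ => Adj.symm⟩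
  exact (Std.Symm.symm _ _ hb').trans hc'

theorem IsSubhypergraph.verts_subset_reach {H L : MultiHypergraph α β} (hL : L.IsSubhypergraph H)
    (hconn : L.Connected) {a : α} (ha : a ∈ L.verts) : L.verts ⊆ H.reach a := by
  intro b hb
  refine mem_reach.2 ⟨hL.1 hb, ?_⟩
  have := (exists_walk_iff ha).1 (hconn a ha b hb)
  refine Relation.ReflTransGen.mono ?_ _ _ this
  rintro x y ⟨e, hne, he, hx, hy⟩
  rw [hL.2.2 e he] at hx hy
  exact ⟨e, hne, hL.2.1 he, (Finset.mem_inter.1 hx).1, (Finset.mem_inter.1 hy).1⟩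

theorem induce_reach_verts (H : MultiHypergraph α β) (a : α) :
    (H.induce (H.reach a)).verts = H.reach a :=
  Finset.inter_eq_right.2 fun _ hb => (mem_reach.1 hb).1

theorem isComponent_induce_reach (H : MultiHypergraph α β) {a : α} (ha : a ∈ H.verts) :
    H.IsComponent (H.induce (H.reach a)) := by
  have hv := H.induce_reach_verts a
  refine ⟨⟨⟨a, hv.symm.subset (mem_reach_self ha)⟩, ⟨Finset.inter_subset_left, Finset.filter_subset _ _,
    fun e _ => by rw [hv]; rfl⟩, H.induce_reach_connected ha,
    fun e he => (Finset.mem_filter.1 he).2⟩, ?_⟩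
  intro L _ hLH hconn hne hKL
  have hLv : L.verts = H.reach a := by
    refine (hLH.verts_subset_reach hconn (hKL.1 (hv.symm.subset (mem_reach_self ha)))).antisymm ?_
    rw [← hv]
    exact hKL.1
  have hLe : L.edges = (H.induce (H.reach a)).edges := by
    refine Finset.Subset.antisymm (fun e he => ?_) hKL.2.1
    refine Finset.mem_filter.2 ⟨hLH.2.1 he, ?_⟩
    rw [← hLv, ← hLH.2.2 e he]
    exact hne e he
  refine MultiHypergraph.ext (hLv.trans hv.symm) hLe ?_
  funext e
  -- Labels that are not edges carry the empty set, so the two incidence functions agree there too.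
  by_cases he : e ∈ L.edges
  · rw [hLH.2.2 e he, hLv]
    rfl
  · rw [L.inc_eq_empty e he, (H.induce (H.reach a)).inc_eq_empty e (hLe ▸ he)]

/-- Connectedness places `K` inside the class of `a`, whose induced subhypergraph is itself
connected; maximality then gives equality. -/
theorem IsComponent.eq_induce_reach {H K : MultiHypergraph α β} (hK : H.IsComponent K) {a : α}
    (ha : a ∈ K.verts) : K = H.induce (H.reach a) := by
  obtain ⟨⟨_, hsub, hconn, hne⟩, hmax⟩ := hK
  have haH := hsub.1 ha
  have hv := H.induce_reach_verts a
  obtain ⟨⟨h1, h2, h3, h4⟩, _⟩ := H.isComponent_induce_reach haH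
  have hKv := hsub.verts_subset_reach hconn ha
  refine (hmax _ h1 h2 h3 h4 ⟨hv.symm ▸ hKv, fun e he => ?_, fun e he => ?_⟩).symm
  · obtain ⟨b, hb⟩ := hne e he
    refine Finset.mem_filter.2 ⟨hsub.2.1 he, b, ?_⟩
    rw [hsub.2.2 e he] at hb
    exact Finset.mem_inter.2 ⟨(Finset.mem_inter.1 hb).1, hKv (Finset.mem_inter.1 hb).2⟩
  · rw [hsub.2.2 e he]
    ext b
    simp only [induce, Finset.mem_inter]
    exact ⟨fun h => ⟨⟨h.1, hKv h.2⟩, h.2⟩, fun h => ⟨h.1.1, h.2⟩⟩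

theorem IsComponent.mem_of_mem_inc {H K : MultiHypergraph α β} (hK : H.IsComponent K) {b c : α}
    {e : β} (he : e ∈ H.edges) (hb : b ∈ H.inc e) (hc : c ∈ H.inc e) (h : b ∈ K.verts) :
    c ∈ K.verts := by
  have hv := congrArg verts (hK.eq_induce_reach h)
  rw [induce_reach_verts] at hv
  rw [hv] at h ⊢
  exact mem_reach_of_mem_inc he hb hc h

theorem IsComponent.mem_edges {H K : MultiHypergraph α β} (hK : H.IsComponent K) {e : β} :
    e ∈ K.edges ↔ e ∈ H.edges ∧ (H.inc e ∩ K.verts).Nonempty := by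
  obtain ⟨a, ha⟩ := hK.1.1
  have hv := congrArg verts (hK.eq_induce_reach ha)
  rw [induce_reach_verts] at hv
  rw [hv]
  nth_rw 1 [hK.eq_induce_reach ha]
  exact Finset.mem_filter

theorem IsComponent.eq_of_mem {H K L : MultiHypergraph α β} (hK : H.IsComponent K)
    (hL : H.IsComponent L) {a : α} (haK : a ∈ K.verts) (haL : a ∈ L.verts) : K = L :=
  (hK.eq_induce_reach haK).trans (hL.eq_induce_reach haL).symm

theorem exists_isComponent_mem (H : MultiHypergraph α β) {a : α} (ha : a ∈ H.verts) :
    ∃ K, H.IsComponent K ∧ a ∈ K.verts :=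
  ⟨_, H.isComponent_induce_reach ha, (H.induce_reach_verts a).symm.subset (mem_reach_self ha)⟩

end Components

/-! ### Degree conditions on the pieces left by a cut. -/

section Pieces

variable {α β : Type*} [DecidableEq α]

section SelDegree

variable {E E' : Finset β} {p q : β → Finset α} {a : α}

theorem selDegree_congr (h : ∀ e ∈ E, p e = q e) : selDegree E p a = selDegree E q a := by
  rw [selDegree, selDegree, Finset.filter_congr fun e he => by rw [h e he]]

theorem selDegree_eq_of_subset (hE : E ⊆ E') (h : ∀ e ∈ E', a ∈ p e → e ∈ E) :
    selDegree E' p a = selDegree E p a := by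
  rw [selDegree, selDegree]
  congr 1
  ext e
  simp only [Finset.mem_filter]
  exact ⟨fun he => ⟨h e he.1 he.2, he.2⟩, fun he => ⟨hE he.1, he.2⟩⟩

theorem selDegree_eq_zero_iff : selDegree E p a = 0 ↔ ∀ e ∈ E, a ∉ p e := by
  rw [selDegree, Finset.card_eq_zero, Finset.filter_eq_empty_iff]

theorem selDegree_eq_card (h : ∀ e ∈ E, a ∈ p e) : selDegree E p a = E.card := by
  rw [selDegree, Finset.filter_true_of_mem h]

theorem selDegree_union [DecidableEq β] (h : Disjoint E E') :
    selDegree (E ∪ E') p a = selDegree E p a + selDegree E' p a := by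
  rw [selDegree, Finset.filter_union,
    Finset.card_union_of_disjoint (Finset.disjoint_filter_filter h)]
  rfl

theorem selDegree_biUnion [DecidableEq β] {ι : Type*} {s : Finset ι} {E : ι → Finset β}
    (h : ∀ i ∈ s, ∀ j ∈ s, i ≠ j → Disjoint (E i) (E j)) :
    selDegree (s.biUnion E) p a = ∑ i ∈ s, selDegree (E i) p a := by
  rw [selDegree, Finset.filter_biUnion, Finset.card_biUnion]
  · rfl
  · exact fun i hi j hj hij => Finset.disjoint_filter_filter (h i hi j hj hij)

theorem selDegree_disjSum {γ : Type*} {F : Finset γ} {p : β ⊕ γ → Finset α} :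
    selDegree (E.disjSum F) p a =
      selDegree E (fun e => p (.inl e)) a + selDegree F (fun e => p (.inr e)) a := by
  simp only [selDegree, Finset.card_filter, Finset.sum_disjSum]

theorem sum_selDegree {A : Finset α} (h : ∀ e ∈ E, p e ⊆ A) :
    ∑ a ∈ A, selDegree E p a = ∑ e ∈ E, (p e).card := by
  have := Finset.sum_card_bipartiteAbove_eq_sum_card_bipartiteBelow (s := A) (t := E)
    (fun a e => a ∈ p e)
  simp only [selDegree]
  refine this.trans (Finset.sum_congr rfl fun e he => ?_)
  congr 1
  ext a
  simp only [Finset.bipartiteBelow, Finset.mem_filter]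
  exact ⟨fun h => h.2, fun ha => ⟨h e he ha, ha⟩⟩

end SelDegree

/-- The edges of `H` whose vertices all belong to `S`. -/
def edgesWithin (H : MultiHypergraph α β) (S : Finset α) : Finset β :=
  H.edges.filter fun e => H.inc e ⊆ S

theorem mem_edgesWithin {H : MultiHypergraph α β} {S : Finset α} {e : β} :
    e ∈ H.edgesWithin S ↔ e ∈ H.edges ∧ H.inc e ⊆ S := Finset.mem_filter

/-- The vertices and edges of `K` are those of a component of `H \ S`. -/
structure IsPiece (H : MultiHypergraph α β) (S : Finset α) (K : MultiHypergraph α β) : Prop where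
  disjoint : Disjoint K.verts S
  mem_edges : ∀ e, e ∈ K.edges ↔ e ∈ H.edges ∧ (H.inc e ∩ K.verts).Nonempty
  inc_eq : ∀ e ∈ K.edges, K.inc e = H.inc e ∩ K.verts
  inc_subset_union : ∀ e ∈ K.edges, H.inc e ⊆ K.verts ∪ S

theorem mem_delete_verts {H : MultiHypergraph α β} {S : Finset α} {a : α} :
    a ∈ (H.delete S).verts ↔ a ∈ H.verts ∧ a ∉ S := by
  simp [delete, induce]

theorem mem_delete_inc {H : MultiHypergraph α β} {S : Finset α} {e : β} {a : α} :
    a ∈ (H.delete S).inc e ↔ a ∈ H.inc e ∧ a ∉ S := by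
  simp only [delete, induce, Finset.mem_inter, Finset.mem_sdiff]
  exact ⟨fun h => ⟨h.1, h.2.2⟩, fun h => ⟨h.1, H.inc_subset e h.1, h.2⟩⟩

theorem mem_delete_edges {H : MultiHypergraph α β} {S : Finset α} {e : β} :
    e ∈ (H.delete S).edges ↔ e ∈ H.edges ∧ ∃ a ∈ H.inc e, a ∉ S := by
  rw [delete, induce, Finset.mem_filter]
  refine and_congr_right fun _ => ?_
  simp only [Finset.Nonempty, Finset.mem_inter, Finset.mem_sdiff]
  exact ⟨fun ⟨a, h⟩ => ⟨a, h.1, h.2.2⟩, fun ⟨a, h⟩ => ⟨a, h.1, H.inc_subset e h.1, h.2⟩⟩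

theorem IsComponent.isPiece {H K : MultiHypergraph α β} {S : Finset α}
    (hK : (H.delete S).IsComponent K) : H.IsPiece S K := by
  have hmem : ∀ a ∈ K.verts, a ∉ S := fun a ha => (mem_delete_verts.1 (hK.1.2.1.1 ha)).2
  have hinter : ∀ e, (H.delete S).inc e ∩ K.verts = H.inc e ∩ K.verts := by
    intro e
    ext a
    simp only [Finset.mem_inter, mem_delete_inc]
    exact ⟨fun h => ⟨h.1.1, h.2⟩, fun h => ⟨⟨h.1, hmem a h.2⟩, h.2⟩⟩
  refine ⟨Finset.disjoint_left.2 hmem, fun e => ?_, fun e he => ?_, fun e he b hb => ?_⟩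
  · rw [hK.mem_edges, hinter, mem_delete_edges]
    refine and_congr_left fun ⟨a, ha⟩ => and_iff_left ?_
    rw [Finset.mem_inter] at ha
    exact ⟨a, ha.1, hmem a ha.2⟩
  · rw [hK.1.2.1.2.2 e he, hinter]
  · obtain ⟨he, a, ha⟩ := hK.mem_edges.1 he
    rw [Finset.mem_inter] at ha
    rw [Finset.mem_union]
    by_cases hbS : b ∈ S
    · exact .inr hbS
    · exact .inl (hK.mem_of_mem_inc he ha.1 (mem_delete_inc.2 ⟨hb, hbS⟩) ha.2)

/-- `p` selects two vertices of every edge of `H` that belongs to the piece `K`, and every vertex of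
`K` is selected by a positive even number of edges of `K`. -/
def IsPieceSelection (H K : MultiHypergraph α β) (p : β → Finset α) : Prop :=
  (∀ e ∈ K.edges, p e ⊆ H.inc e ∧ (p e).card = 2) ∧
  ∀ a ∈ K.verts, Even (selDegree K.edges p a) ∧ 0 < selDegree K.edges p a

variable {H K : MultiHypergraph α β} {S : Finset α} {p : β → Finset α}

theorem IsPieceSelection.congr {q : β → Finset α} (hp : H.IsPieceSelection K p)
    (h : ∀ e ∈ K.edges, p e = q e) : H.IsPieceSelection K q := by
  refine ⟨fun e he => h e he ▸ hp.1 e he, fun a ha => ?_⟩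
  rw [← selDegree_congr h]
  exact hp.2 a ha

/-- Handshake lemma: all degrees in the piece sum to twice the number of its edges, and the vertices
outside `S` contribute an even amount. -/
theorem IsPieceSelection.even_sum (hK : H.IsPiece S K) (hp : H.IsPieceSelection K p) :
    Even (∑ a ∈ S, selDegree K.edges p a) := by
  have h := sum_selDegree (p := p) (E := K.edges) (A := K.verts ∪ S)
    fun e he => (hp.1 e he).1.trans (hK.inc_subset_union e he)
  rw [Finset.sum_union hK.disjoint] at h
  have h1 : Even (∑ a ∈ K.verts, selDegree K.edges p a) :=
    Finset.even_sum _ fun a ha => (hp.2 a ha).1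
  have h2 : Even (∑ e ∈ K.edges, (p e).card) :=
    Finset.even_sum _ fun e he => by rw [(hp.1 e he).2]; exact even_two
  rw [← h] at h2
  exact (Nat.even_add.1 h2).1 h1

theorem IsPiece.hasSpanningEulerFamily_iff (hK : H.IsPiece S K) :
    K.HasSpanningEulerFamily ↔
      ∃ p, H.IsPieceSelection K p ∧ ∀ a ∈ S, selDegree K.edges p a = 0 := by
  rw [MultiHypergraph.hasSpanningEulerFamily_iff]
  refine exists_congr fun p => ⟨fun hp => ⟨⟨fun e he => ⟨(hp.1 e he).1.trans ?_, (hp.1 e he).2⟩,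
    hp.2⟩, fun a ha => selDegree_eq_zero_iff.2 fun e he hae => ?_⟩,
    fun ⟨hp, h0⟩ => ⟨fun e he => ⟨fun a ha => ?_, (hp.1 e he).2⟩, hp.2⟩⟩
  · rw [hK.inc_eq e he]
    exact Finset.inter_subset_left
  · exact Finset.disjoint_left.1 hK.disjoint (K.inc_subset e ((hp.1 e he).1 hae)) ha
  · rw [hK.inc_eq e he, Finset.mem_inter]
    have ha' := (hp.1 e he).1 ha
    refine ⟨ha', (Finset.mem_union.1 (hK.inc_subset_union e he ha')).resolve_right fun haS => ?_⟩
    exact selDegree_eq_zero_iff.1 (h0 a haS) e he ha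

theorem IsPiece.disjoint_edgesWithin (hK : H.IsPiece S K) :
    Disjoint K.edges (H.edgesWithin S) := by
  rw [Finset.disjoint_left]
  intro e he he'
  obtain ⟨a, ha⟩ := ((hK.mem_edges e).1 he).2
  rw [Finset.mem_inter] at ha
  exact Finset.disjoint_left.1 hK.disjoint ha.2 ((mem_edgesWithin.1 he').2 ha.1)

/-- Two vertices chosen inside a two-element set exhaust it; in particular an edge with just one
vertex, lying in `S`, rules out any selection. -/
theorem sel_eq_of_mem_edgesWithin (hS : S.card = 2)
    (hp : ∀ e ∈ H.edgesWithin S, p e ⊆ H.inc e ∧ (p e).card = 2) {e : β}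
    (he : e ∈ H.edgesWithin S) : p e = S ∧ H.inc e = S := by
  obtain ⟨h1, h2⟩ := hp e he
  have h3 := (mem_edgesWithin.1 he).2
  have h4 : p e = S := Finset.eq_of_subset_of_card_le (h1.trans h3) (by omega)
  exact ⟨h4, h3.antisymm (h4 ▸ h1)⟩

variable [DecidableEq β]

theorem IsPiece.sComponent_edges (hK : H.IsPiece S K) (hH : H.NoEmptyEdges) :
    (H.sComponent S K).edges = K.edges ∪ H.edgesWithin S := by
  ext e
  simp only [sComponent, Finset.mem_filter, Finset.mem_union, mem_edgesWithin]
  constructor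
  · rintro ⟨he, hsub, -⟩
    by_cases hn : (H.inc e ∩ K.verts).Nonempty
    · exact .inl ((hK.mem_edges e).2 ⟨he, hn⟩)
    · refine .inr ⟨he, fun a ha => (Finset.mem_union.1 (hsub ha)).resolve_left fun haK => ?_⟩
      exact hn ⟨a, Finset.mem_inter.2 ⟨ha, haK⟩⟩
  · rintro (he | ⟨he, hsub⟩)
    · have he' := ((hK.mem_edges e).1 he).1
      exact ⟨he', hK.inc_subset_union e he, (hH e he').ne_empty⟩
    · exact ⟨he, hsub.trans Finset.subset_union_right, (hH e he).ne_empty⟩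

theorem sComponent_inc {e : β} (he : e ∈ (H.sComponent S K).edges) :
    (H.sComponent S K).inc e = H.inc e :=
  if_pos (Finset.mem_filter.1 he)

theorem selDegree_sComponent_of_mem (hK : H.IsPiece S K) (hH : H.NoEmptyEdges)
    (hp : ∀ e ∈ (H.sComponent S K).edges, p e ⊆ H.inc e) {a : α} (ha : a ∈ K.verts) :
    selDegree (H.sComponent S K).edges p a = selDegree K.edges p a := by
  have hE := hK.sComponent_edges hH
  refine selDegree_eq_of_subset (hE ▸ Finset.subset_union_left) fun e he hae => ?_
  exact (hK.mem_edges e).2 ⟨(Finset.mem_filter.1 he).1, a, Finset.mem_inter.2 ⟨hp e he hae, ha⟩⟩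

theorem selDegree_sComponent_of_mem_cut (hK : H.IsPiece S K) (hH : H.NoEmptyEdges)
    (hp : ∀ e ∈ H.edgesWithin S, p e = S) {a : α} (ha : a ∈ S) :
    selDegree (H.sComponent S K).edges p a =
      selDegree K.edges p a + (H.edgesWithin S).card := by
  rw [hK.sComponent_edges hH, selDegree_union hK.disjoint_edgesWithin,
    selDegree_eq_card (E := H.edgesWithin S) fun e he => (hp e he).symm ▸ ha]

/-- Edges inside `S` are not edges of the piece, so their selection can be prescribed freely. -/
theorem IsPiece.exists_extension (hK : H.IsPiece S K) (hp : H.IsPieceSelection K p) :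
    ∃ q, H.IsPieceSelection K q ∧ (∀ e ∈ K.edges, p e = q e) ∧ ∀ e ∈ H.edgesWithin S, q e = S := by
  have h : ∀ e ∈ K.edges, p e = if e ∈ K.edges then p e else S := fun e he => by rw [if_pos he]
  refine ⟨fun e => if e ∈ K.edges then p e else S, hp.congr h, h, fun e he => if_neg fun he' => ?_⟩
  exact Finset.disjoint_left.1 hK.disjoint_edgesWithin he' he

/-- Every edge inside `S` must select both cut vertices, so together they shift both degrees by
their number. -/
theorem IsPiece.sComponent_hasSpanningEulerFamily_iff (hK : H.IsPiece S K) (hH : H.NoEmptyEdges)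
    (hS : S.card = 2) :
    (H.sComponent S K).HasSpanningEulerFamily ↔
      (∀ e ∈ H.edgesWithin S, H.inc e = S) ∧ ∃ p, H.IsPieceSelection K p ∧
        ∀ a ∈ S, Even (selDegree K.edges p a + (H.edgesWithin S).card) ∧
          0 < selDegree K.edges p a + (H.edgesWithin S).card := by
  rw [MultiHypergraph.hasSpanningEulerFamily_iff]
  have hE := hK.sComponent_edges hH
  constructor
  · rintro ⟨p, hp, hdeg⟩
    have hp' : ∀ e ∈ (H.sComponent S K).edges, p e ⊆ H.inc e ∧ (p e).card = 2 :=
      fun e he => sComponent_inc he ▸ hp e he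
    have hB : ∀ e ∈ H.edgesWithin S, p e = S ∧ H.inc e = S := fun e he =>
      sel_eq_of_mem_edgesWithin hS (fun e he => hp' e (hE ▸ Finset.mem_union_right _ he)) he
    refine ⟨fun e he => (hB e he).2, p,
      ⟨fun e he => hp' e (hE ▸ Finset.mem_union_left _ he), fun a ha => ?_⟩, fun a ha => ?_⟩
    · rw [← selDegree_sComponent_of_mem hK hH (fun e he => (hp' e he).1) ha]
      exact hdeg a (Finset.mem_union_left _ ha)
    · rw [← selDegree_sComponent_of_mem_cut hK hH (fun e he => (hB e he).1) ha]
      exact hdeg a (Finset.mem_union_right _ ha)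
  · rintro ⟨hB, p, hp, hdeg⟩
    obtain ⟨q, hq, hpq, hqS⟩ := hK.exists_extension hp
    have hq' : ∀ e ∈ (H.sComponent S K).edges, q e ⊆ H.inc e ∧ (q e).card = 2 := by
      intro e he
      rw [hE, Finset.mem_union] at he
      rcases he with he | he
      · exact hq.1 e he
      · rw [hqS e he, hB e he]
        exact ⟨subset_rfl, hS⟩
    refine ⟨q, fun e he => (sComponent_inc he).symm ▸ hq' e he, fun a ha => ?_⟩
    rcases Finset.mem_union.1 ha with ha | ha
    · rw [selDegree_sComponent_of_mem hK hH (fun e he => (hq' e he).1) ha]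
      exact hq.2 a ha
    · rw [selDegree_sComponent_of_mem_cut hK hH hqS ha, ← selDegree_congr hpq]
      exact hdeg a ha

/-- The additional copy of `S` raises both cut degrees by one: evenness becomes oddness of the rest,
and positivity comes for free. -/
theorem IsPiece.sStarComponent_hasSpanningEulerFamily_iff (hK : H.IsPiece S K)
    (hH : H.NoEmptyEdges) (hS : S.card = 2) :
    (H.sStarComponent S K).HasSpanningEulerFamily ↔
      (∀ e ∈ H.edgesWithin S, H.inc e = S) ∧ ∃ p, H.IsPieceSelection K p ∧
        ∀ a ∈ S, Odd (selDegree K.edges p a + (H.edgesWithin S).card) := by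
  rw [MultiHypergraph.hasSpanningEulerFamily_iff]
  have hE := hK.sComponent_edges hH
  have hcard : (Finset.univ : Finset (Fin (S.card / 2))).card = 1 := by simp [hS]
  have hdisj : ∀ a ∈ K.verts, a ∉ S := fun a ha => Finset.disjoint_left.1 hK.disjoint ha
  have hsplit : ∀ (p : β ⊕ Fin (S.card / 2) → Finset α) (a : α),
      selDegree (H.sStarComponent S K).edges p a =
        selDegree (H.sComponent S K).edges (fun e => p (.inl e)) a +
          selDegree Finset.univ (fun j => p (.inr j)) a := fun p a => selDegree_disjSum
  constructor
  · rintro ⟨p, hp, hdeg⟩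
    have hp' : ∀ e ∈ (H.sComponent S K).edges, p (.inl e) ⊆ H.inc e ∧ (p (.inl e)).card = 2 :=
      fun e he => sComponent_inc he ▸ hp (.inl e) (Finset.inl_mem_disjSum.2 he)
    have hB : ∀ e ∈ H.edgesWithin S, p (.inl e) = S ∧ H.inc e = S := fun e he =>
      sel_eq_of_mem_edgesWithin (p := fun e => p (.inl e)) hS
        (fun e he => hp' e (hE ▸ Finset.mem_union_right _ he)) he
    have hnew : ∀ j, p (.inr j) = S := by
      intro j
      obtain ⟨h1, h2⟩ := hp (.inr j) (Finset.inr_mem_disjSum.2 (Finset.mem_univ _))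
      exact Finset.eq_of_subset_of_card_le h1 (by omega)
    refine ⟨fun e he => (hB e he).2, fun e => p (.inl e),
      ⟨fun e he => hp' e (hE ▸ Finset.mem_union_left _ he), fun a ha => ?_⟩, fun a ha => ?_⟩
    · have := hdeg a (Finset.mem_union_left _ ha)
      rw [hsplit, selDegree_sComponent_of_mem hK hH (fun e he => (hp' e he).1) ha,
        selDegree_eq_zero_iff (E := Finset.univ).2 fun j _ => (hnew j).symm ▸ hdisj a ha] at this
      exact this
    · have := (hdeg a (Finset.mem_union_right _ ha)).1
      rw [hsplit, selDegree_sComponent_of_mem_cut hK hH (fun e he => (hB e he).1) ha,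
        selDegree_eq_card (E := Finset.univ) fun j _ => (hnew j).symm ▸ ha, hcard] at this
      grind
  · rintro ⟨hB, p, hp, hdeg⟩
    obtain ⟨q, hq, hpq, hqS⟩ := hK.exists_extension hp
    have hq' : ∀ e ∈ (H.sComponent S K).edges, q e ⊆ H.inc e ∧ (q e).card = 2 := by
      intro e he
      rw [hE, Finset.mem_union] at he
      rcases he with he | he
      · exact hq.1 e he
      · rw [hqS e he, hB e he]
        exact ⟨subset_rfl, hS⟩
    refine ⟨Sum.elim q fun _ => S, fun e he => ?_, fun a ha => ?_⟩
    · rcases e with e | j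
      · have he := Finset.inl_mem_disjSum.1 he
        exact (sComponent_inc he).symm ▸ hq' e he
      · exact ⟨subset_rfl, hS⟩
    · rw [hsplit]
      simp only [Sum.elim_inl, Sum.elim_inr]
      rcases Finset.mem_union.1 ha with ha | ha
      · rw [selDegree_sComponent_of_mem hK hH (fun e he => (hq' e he).1) ha,
          selDegree_eq_zero_iff.2 fun _ _ => hdisj a ha]
        exact hq.2 a ha
      · rw [selDegree_sComponent_of_mem_cut hK hH hqS ha, ← selDegree_congr hpq,
          selDegree_eq_card fun _ _ => ha, hcard]
        have := hdeg a ha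
        exact ⟨this.add_one, by omega⟩

/-- Once `x` is deleted, an edge inside `S` keeps at most the vertex `y`, too few for a selection.
Hence it must vanish, which means that it was `{x}`. -/
theorem IsPiece.sComponent_delete_hasSpanningEulerFamily_iff (hK : H.IsPiece S K)
    (hH : H.NoEmptyEdges) {x y : α} (hxy : x ≠ y) (hS : S = {x, y}) :
    ((H.sComponent S K).delete {x}).HasSpanningEulerFamily ↔
      (∀ e ∈ H.edgesWithin S, H.inc e = {x}) ∧ ∃ p, H.IsPieceSelection K p ∧
        selDegree K.edges p x = 0 ∧ Even (selDegree K.edges p y) ∧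
          0 < selDegree K.edges p y := by
  rw [MultiHypergraph.hasSpanningEulerFamily_iff]
  have hE := hK.sComponent_edges hH
  have hdisj : ∀ a ∈ K.verts, a ∉ S := fun a ha => Finset.disjoint_left.1 hK.disjoint ha
  have hxS : x ∈ S := by simp [hS]
  have hyS : y ∈ S := by simp [hS]
  have hsubE : K.edges ⊆ ((H.sComponent S K).delete {x}).edges := by
    intro e he
    have he' : e ∈ (H.sComponent S K).edges := hE ▸ Finset.mem_union_left _ he
    obtain ⟨a, ha⟩ := ((hK.mem_edges e).1 he).2
    rw [Finset.mem_inter] at ha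
    refine mem_delete_edges.2 ⟨he', a, (sComponent_inc he').symm ▸ ha.1, ?_⟩
    rw [Finset.mem_singleton]
    rintro rfl
    exact hdisj _ ha.2 hxS
  have hEeq : (∀ e ∈ H.edgesWithin S, H.inc e = {x}) →
      ((H.sComponent S K).delete {x}).edges = K.edges := by
    intro hB
    refine Finset.Subset.antisymm (fun e he => ?_) hsubE
    obtain ⟨he', a, ha, hax⟩ := mem_delete_edges.1 he
    rw [sComponent_inc he'] at ha
    rw [hE, Finset.mem_union] at he'
    refine he'.resolve_right fun hw => ?_
    rw [hB e hw] at ha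
    exact hax ha
  have hinc : ∀ e ∈ ((H.sComponent S K).delete {x}).edges, ∀ a,
      a ∈ ((H.sComponent S K).delete {x}).inc e ↔ a ∈ H.inc e ∧ a ≠ x := by
    intro e he a
    rw [mem_delete_inc, sComponent_inc (mem_delete_edges.1 he).1, Finset.mem_singleton]
  have hverts : ∀ a, a ∈ ((H.sComponent S K).delete {x}).verts ↔ a ∈ K.verts ∨ a = y := by
    intro a
    rw [mem_delete_verts, Finset.mem_singleton]
    change a ∈ K.verts ∪ S ∧ a ≠ x ↔ _
    rw [Finset.mem_union]
    constructor
    · rintro ⟨h | h, hax⟩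
      · exact .inl h
      · rw [hS, Finset.mem_insert, Finset.mem_singleton] at h
        exact .inr (h.resolve_left hax)
    · rintro (h | rfl)
      · exact ⟨.inl h, by rintro rfl; exact hdisj _ h hxS⟩
      · exact ⟨.inr hyS, hxy.symm⟩
  constructor
  · rintro ⟨p, hp, hdeg⟩
    have hB : ∀ e ∈ H.edgesWithin S, H.inc e = {x} := by
      intro e he
      have hesub := (mem_edgesWithin.1 he).2
      rw [Finset.eq_singleton_iff_nonempty_unique_mem]
      refine ⟨hH e (mem_edgesWithin.1 he).1, fun a ha => ?_⟩
      by_contra hax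
      have he' : e ∈ (H.sComponent S K).edges := hE ▸ Finset.mem_union_right _ he
      have he'' : e ∈ ((H.sComponent S K).delete {x}).edges :=
        mem_delete_edges.2 ⟨he', a, (sComponent_inc he').symm ▸ ha, by simpa using hax⟩
      obtain ⟨h1, h2⟩ := hp e he''
      have h3 : p e ⊆ {y} := by
        intro b hb
        have := (hinc e he'' b).1 (h1 hb)
        have hbS := hesub this.1
        rw [hS, Finset.mem_insert, Finset.mem_singleton] at hbS
        simpa using hbS.resolve_left this.2
      have := Finset.card_le_card h3
      simp at this
      omega
    rw [hEeq hB] at hinc hp hdeg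
    have hsel : ∀ e ∈ K.edges, ∀ a ∈ p e, a ∈ H.inc e ∧ a ≠ x :=
      fun e he a ha => (hinc e he a).1 ((hp e he).1 ha)
    exact ⟨hB, p, ⟨fun e he => ⟨fun a ha => (hsel e he a ha).1, (hp e he).2⟩,
      fun a ha => hdeg a ((hverts a).2 (.inl ha))⟩,
      selDegree_eq_zero_iff.2 fun e he hx => (hsel e he x hx).2 rfl,
      hdeg y ((hverts y).2 (.inr rfl))⟩
  · rintro ⟨hB, p, hp, hx, hy⟩
    refine ⟨p, fun e he => ?_, fun a ha => ?_⟩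
    · have he' := hEeq hB ▸ he
      refine ⟨fun a ha => (hinc e he a).2 ⟨(hp.1 e he').1 ha, ?_⟩, (hp.1 e he').2⟩
      rintro rfl
      exact selDegree_eq_zero_iff.1 hx e he' ha
    · rw [hEeq hB]
      rcases (hverts a).1 ha with ha | rfl
      · exact hp.2 a ha
      · exact hy

/-- The pieces and the edges inside `S` partition the edges of `H`, so independent selections on the
pieces glue; they interact only through the degrees at the cut vertices. -/
theorem hasSpanningEulerFamily_iff_pieces (hS : S.card = 2) (hSH : S ⊆ H.verts)
    {ι : Type*} [Fintype ι] {C : ι → MultiHypergraph α β}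
    (hC : ∀ i, H.IsPiece S (C i)) (hCH : ∀ i, (C i).verts ⊆ H.verts)
    (hcov : ∀ a ∈ H.verts, a ∉ S → ∃ i, a ∈ (C i).verts)
    (hdisj : ∀ i j, i ≠ j → Disjoint (C i).edges (C j).edges) :
    H.HasSpanningEulerFamily ↔
      (∀ e ∈ H.edgesWithin S, H.inc e = S) ∧ ∃ p : ι → β → Finset α,
        (∀ i, H.IsPieceSelection (C i) (p i)) ∧
        ∀ a ∈ S, Even (∑ i, selDegree (C i).edges (p i) a + (H.edgesWithin S).card) ∧
          0 < ∑ i, selDegree (C i).edges (p i) a + (H.edgesWithin S).card := by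
  classical
  rw [MultiHypergraph.hasSpanningEulerFamily_iff]
  have hsub : ∀ i, (C i).edges ⊆ H.edges := fun i e he => (((hC i).mem_edges e).1 he).1
  have hE : H.edges = Finset.univ.biUnion (fun i => (C i).edges) ∪ H.edgesWithin S := by
    ext e
    simp only [Finset.mem_union, Finset.mem_biUnion, Finset.mem_univ, true_and, mem_edgesWithin]
    constructor
    · intro he
      by_cases h : H.inc e ⊆ S
      · exact .inr ⟨he, h⟩
      · obtain ⟨a, ha, haS⟩ := Finset.not_subset.1 h
        obtain ⟨i, hi⟩ := hcov a (H.inc_subset e ha) haS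
        exact .inl ⟨i, ((hC i).mem_edges e).2 ⟨he, a, Finset.mem_inter.2 ⟨ha, hi⟩⟩⟩
    · rintro (⟨i, he⟩ | he)
      · exact hsub i he
      · exact he.1
  have hin : ∀ (p : β → Finset α), (∀ e ∈ H.edges, p e ⊆ H.inc e) → ∀ i, ∀ a ∈ (C i).verts,
      selDegree H.edges p a = selDegree (C i).edges p a := by
    intro p hp i a ha
    refine selDegree_eq_of_subset (hsub i) fun e he hae => ?_
    exact ((hC i).mem_edges e).2 ⟨he, a, Finset.mem_inter.2 ⟨hp e he hae, ha⟩⟩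
  have hcut : ∀ (p : β → Finset α), (∀ e ∈ H.edgesWithin S, p e = S) → ∀ a ∈ S,
      selDegree H.edges p a = ∑ i, selDegree (C i).edges p a + (H.edgesWithin S).card := by
    intro p hp a ha
    rw [hE, selDegree_union, selDegree_biUnion fun i _ j _ => hdisj i j,
      selDegree_eq_card (E := H.edgesWithin S) fun e he => (hp e he).symm ▸ ha]
    rw [Finset.disjoint_biUnion_left]
    exact fun i _ => (hC i).disjoint_edgesWithin
  constructor
  · rintro ⟨p, hp, hdeg⟩
    have hB : ∀ e ∈ H.edgesWithin S, p e = S ∧ H.inc e = S := fun e he =>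
      sel_eq_of_mem_edgesWithin hS (fun e he => hp e (mem_edgesWithin.1 he).1) he
    refine ⟨fun e he => (hB e he).2, fun _ => p,
      fun i => ⟨fun e he => hp e (hsub i he), fun a ha => ?_⟩, fun a ha => ?_⟩
    · rw [← hin p (fun e he => (hp e he).1) i a ha]
      exact hdeg a (hCH i ha)
    · rw [← hcut p (fun e he => (hB e he).1) a ha]
      exact hdeg a (hSH ha)
  · rintro ⟨hB, q, hq, hdeg⟩
    have hex : ∀ e, ∃ s : Finset α, (∀ i, e ∈ (C i).edges → s = q i e) ∧
        (e ∈ H.edgesWithin S → s = S) := by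
      intro e
      by_cases h : ∃ i, e ∈ (C i).edges
      · obtain ⟨i, hi⟩ := h
        refine ⟨q i e, fun j hj => ?_, fun he => ?_⟩
        · by_cases hij : i = j
          · rw [hij]
          · exact absurd hj (Finset.disjoint_left.1 (hdisj i j hij) hi)
        · exact absurd he (Finset.disjoint_left.1 (hC i).disjoint_edgesWithin hi)
      · exact ⟨S, fun i hi => absurd ⟨i, hi⟩ h, fun _ => rfl⟩
    choose p hpq hpS using hex
    have hp : ∀ i, H.IsPieceSelection (C i) p := fun i =>
      (hq i).congr fun e he => (hpq e i he).symm
    have hpH : ∀ e ∈ H.edges, p e ⊆ H.inc e ∧ (p e).card = 2 := by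
      intro e he
      rw [hE, Finset.mem_union, Finset.mem_biUnion] at he
      rcases he with ⟨i, -, hi⟩ | he
      · exact (hp i).1 e hi
      · rw [hpS e he, hB e he]
        exact ⟨subset_rfl, hS⟩
    refine ⟨p, hpH, fun a ha => ?_⟩
    by_cases haS : a ∈ S
    · rw [hcut p hpS a haS,
        Finset.sum_congr rfl fun i _ => selDegree_congr fun e he => hpq e i he]
      exact hdeg a haS
    · obtain ⟨i, hi⟩ := hcov a ha haS
      rw [hin p (fun e he => (hpH e he).1) i a hi]
      exact (hp i).2 a hi

end Pieces

/-! ### Parity bookkeeping and the two-vertex cut theorem. -/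

section Cut

variable {α β : Type*} [DecidableEq α]

theorem even_card_edgesWithin {H : MultiHypergraph α β} {S : Finset α}
    (heven : Even (H.edges.filter fun e => H.inc e = S).card)
    (hB : ∀ e ∈ H.edgesWithin S, H.inc e = S) : Even (H.edgesWithin S).card := by
  convert heven using 2
  ext e
  rw [mem_edgesWithin, Finset.mem_filter]
  exact ⟨fun h => ⟨h.1, hB e (mem_edgesWithin.2 h)⟩, fun h => ⟨h.1, h.2.subset⟩⟩

theorem even_sum_selDegree_iff {k : ℕ} (d : Fin k → ℕ) (I : Finset (Fin k))
    (hd : ∀ i, Odd (d i) ↔ i ∈ I) : Even (∑ i, d i) ↔ Even I.card := by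
  rw [Finset.even_sum_iff_even_card_odd]
  simp [hd]

end Cut

end MultiHypergraph

open MultiHypergraph

theorem theorem3p12 {α β : Type*} [DecidableEq α] [DecidableEq β]
    (H : MultiHypergraph α β) (hH : H.NoEmptyEdges)
    (u v : α) (huv : u ≠ v) (S : Finset α) (hS : S = {u, v}) (hcut : H.IsVertexCut S)
    (heven : Even (H.edges.filter fun e => H.inc e = S).card)
    (k : ℕ) (C : Fin k → MultiHypergraph α β) (hinj : Function.Injective C)
    (hC : ∀ K : MultiHypergraph α β, (H.delete S).IsComponent K ↔ ∃ i, C i = K) :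
    H.HasSpanningEulerFamily ↔
      ∃ I : Finset (Fin k), Even I.card ∧
        (∀ i ∈ I, (H.sStarComponent S (C i)).HasSpanningEulerFamily) ∧
        (∀ i, i ∉ I →
          (C i).HasSpanningEulerFamily ∨
          (H.sComponent S (C i)).HasSpanningEulerFamily ∨
          ((H.sComponent S (C i)).delete {u}).HasSpanningEulerFamily ∨
          ((H.sComponent S (C i)).delete {v}).HasSpanningEulerFamily) ∧
        (I = ∅ →
          (∃ i, (H.sComponent S (C i)).HasSpanningEulerFamily) ∨
          (∃ i j, i ≠ j ∧
            ((H.sComponent S (C i)).delete {u}).HasSpanningEulerFamily ∧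
            ((H.sComponent S (C j)).delete {v}).HasSpanningEulerFamily)) := by
  have hcard : S.card = 2 := hS ▸ Finset.card_pair huv
  have hcomp : ∀ i, (H.delete S).IsComponent (C i) := fun i => (hC _).2 ⟨i, rfl⟩
  have hpiece : ∀ i, H.IsPiece S (C i) := fun i => (hcomp i).isPiece
  have hCH : ∀ i, (C i).verts ⊆ H.verts :=
    fun i a ha => (mem_delete_verts.1 ((hcomp i).1.2.1.1 ha)).1
  have hcov : ∀ a ∈ H.verts, a ∉ S → ∃ i, a ∈ (C i).verts := by
    intro a ha haS
    obtain ⟨K, hK, haK⟩ := (H.delete S).exists_isComponent_mem (mem_delete_verts.2 ⟨ha, haS⟩)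
    obtain ⟨i, rfl⟩ := (hC K).1 hK
    exact ⟨i, haK⟩
  have hdisj : ∀ i j, i ≠ j → Disjoint (C i).edges (C j).edges := by
    intro i j hij
    rw [Finset.disjoint_left]
    intro e hi hj
    obtain ⟨he, a, ha⟩ := (hcomp i).mem_edges.1 hi
    obtain ⟨-, b, hb⟩ := (hcomp j).mem_edges.1 hj
    rw [Finset.mem_inter] at ha hb
    exact hij (hinj ((hcomp i).eq_of_mem (hcomp j)
      ((hcomp i).mem_of_mem_inc he ha.1 hb.1 ha.2) hb.2))
  have hne : ∃ _ : Fin k, True := by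
    obtain ⟨a, ha, haS⟩ := Finset.exists_of_ssubset hcut.1
    obtain ⟨i, -⟩ := hcov a ha haS
    exact ⟨i, trivial⟩
  have hS' : S = {v, u} := hS.trans (Finset.pair_comm u v)
  have hforall : ∀ P : α → Prop, (∀ a ∈ S, P a) ↔ P u ∧ P v := by
    intro P
    simp [hS]
  rw [hasSpanningEulerFamily_iff_pieces hcard hcut.1.1 hpiece hCH hcov hdisj]
  simp only [fun i => (hpiece i).hasSpanningEulerFamily_iff,
    fun i => (hpiece i).sComponent_hasSpanningEulerFamily_iff hH hcard,
    fun i => (hpiece i).sStarComponent_hasSpanningEulerFamily_iff hH hcard,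
    fun i => (hpiece i).sComponent_delete_hasSpanningEulerFamily_iff hH huv hS,
    fun i => (hpiece i).sComponent_delete_hasSpanningEulerFamily_iff hH huv.symm hS', hforall]
  have hpar : ∀ i p, H.IsPieceSelection (C i) p →
      (Even (selDegree (C i).edges p u) ↔ Even (selDegree (C i).edges p v)) := by
    intro i p hp
    have := hp.even_sum (hpiece i)
    rw [hS, Finset.sum_pair huv] at this
    exact Nat.even_add.1 this
  clear hforall hcov hdisj hCH hcomp hC
  constructor
  · rintro ⟨hB, p, hp, ⟨hue, hu0⟩, -, hv0⟩
    have hm := even_card_edgesWithin heven hB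
    -- `I` consists of the components with odd degree at `u`, equivalently at `v`.
    refine ⟨Finset.univ.filter fun i => Odd (selDegree (C i).edges (p i) u), ?_, ?_, ?_, ?_⟩
    · rw [← even_sum_selDegree_iff (fun i => selDegree (C i).edges (p i) u) _ (by simp)]
      exact (Nat.even_add.1 hue).2 hm
    · intro i hi
      have hi : Odd (selDegree (C i).edges (p i) u) := by simpa using hi
      have := hpar i (p i) (hp i)
      exact ⟨hB, p i, hp i, by grind, by grind⟩
    · intro i hi
      have hi : Even (selDegree (C i).edges (p i) u) := by simpa using hi
      have hv := (hpar i (p i) (hp i)).1 hi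
      -- Without edges inside `S`, which of the two even degrees vanish decides among the four
      -- alternatives. With such edges, `H_i'` always works.
      rcases Nat.eq_zero_or_pos (H.edgesWithin S).card with h0 | h0
      · have hBx : ∀ x, ∀ e ∈ H.edgesWithin S, H.inc e = {x} := by
          rw [Finset.card_eq_zero] at h0
          simp [h0]
        rw [h0]
        rcases Nat.eq_zero_or_pos (selDegree (C i).edges (p i) u) with h1 | h1 <;>
        rcases Nat.eq_zero_or_pos (selDegree (C i).edges (p i) v) with h2 | h2
        · exact .inl ⟨p i, hp i, h1, h2⟩
        · exact .inr (.inr (.inl ⟨hBx u, p i, hp i, h1, hv, h2⟩))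
        · exact .inr (.inr (.inr ⟨hBx v, p i, hp i, h2, hi, h1⟩))
        · exact .inr (.inl ⟨hB, p i, hp i, ⟨hi, h1⟩, hv, h2⟩)
      · exact .inr (.inl ⟨hB, p i, hp i, ⟨hi.add hm, by omega⟩, hv.add hm, by omega⟩)
    · intro hI
      have hi : ∀ i, Even (selDegree (C i).edges (p i) u) := by
        simpa [Finset.filter_eq_empty_iff] using hI
      have hv : ∀ i, Even (selDegree (C i).edges (p i) v) :=
        fun i => (hpar i (p i) (hp i)).1 (hi i)
      rcases Nat.eq_zero_or_pos (H.edgesWithin S).card with h0 | h0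
      · have hBx : ∀ x, ∀ e ∈ H.edgesWithin S, H.inc e = {x} := by
          rw [Finset.card_eq_zero] at h0
          simp [h0]
        simp only [h0, Nat.add_zero] at hu0 hv0 ⊢
        -- Some component `i` reaches `u` and some `j` reaches `v`. Either one of them reaches both,
        -- giving (a), or `i` misses `v` and `j` misses `u`, giving (b).
        obtain ⟨i, -, hiu⟩ := Finset.exists_ne_zero_of_sum_ne_zero hu0.ne'
        obtain ⟨j, -, hjv⟩ := Finset.exists_ne_zero_of_sum_ne_zero hv0.ne'
        by_cases hiv : selDegree (C i).edges (p i) v = 0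
        · by_cases hju : selDegree (C j).edges (p j) u = 0
          · refine .inr ⟨j, i, ?_, ⟨hBx u, p j, hp j, hju, hv j, by omega⟩,
              hBx v, p i, hp i, hiv, hi i, by omega⟩
            rintro rfl
            exact hiu hju
          · exact .inl ⟨j, hB, p j, hp j, ⟨hi j, by omega⟩, hv j, by omega⟩
        · exact .inl ⟨i, hB, p i, hp i, ⟨hi i, by omega⟩, hv i, by omega⟩
      · obtain ⟨i, -⟩ := hne
        exact .inl ⟨i, hB, p i, hp i, ⟨(hi i).add hm, by omega⟩, (hv i).add hm, by omega⟩
  · rintro ⟨I, hI, h1, h2, h3⟩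
    -- Once the parities on the components follow `I`, evenness at the cut is automatic, and one
    -- witness of positivity at each of `u` and `v` suffices.
    have hfin : (∀ e ∈ H.edgesWithin S, H.inc e = S) → ∀ p : Fin k → β → Finset α,
        (∀ i, H.IsPieceSelection (C i) (p i) ∧ (Odd (selDegree (C i).edges (p i) u) ↔ i ∈ I)) →
        (∃ i, 0 < selDegree (C i).edges (p i) u + (H.edgesWithin S).card) →
        (∃ i, 0 < selDegree (C i).edges (p i) v + (H.edgesWithin S).card) →
        ∃ p : Fin k → β → Finset α, (∀ i, H.IsPieceSelection (C i) (p i)) ∧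
          (Even (∑ i, selDegree (C i).edges (p i) u + (H.edgesWithin S).card) ∧
            0 < ∑ i, selDegree (C i).edges (p i) u + (H.edgesWithin S).card) ∧
          (Even (∑ i, selDegree (C i).edges (p i) v + (H.edgesWithin S).card) ∧
            0 < ∑ i, selDegree (C i).edges (p i) v + (H.edgesWithin S).card) := by
      rintro hB p hp ⟨i, hi⟩ ⟨j, hj⟩
      have hm := even_card_edgesWithin heven hB
      have hp' : ∀ i, Odd (selDegree (C i).edges (p i) v) ↔ i ∈ I := fun i => by
        rw [← (hp i).2, ← Nat.not_even_iff_odd, ← Nat.not_even_iff_odd, hpar i _ (hp i).1]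
      have hsu := Finset.single_le_sum (f := fun i => selDegree (C i).edges (p i) u)
        (fun _ _ => Nat.zero_le _) (Finset.mem_univ i)
      have hsv := Finset.single_le_sum (f := fun i => selDegree (C i).edges (p i) v)
        (fun _ _ => Nat.zero_le _) (Finset.mem_univ j)
      refine ⟨p, fun i => (hp i).1, ⟨Even.add ?_ hm, ?_⟩, Even.add ?_ hm, ?_⟩
      · exact (even_sum_selDegree_iff _ I fun i => (hp i).2).2 hI
      · exact lt_of_lt_of_le hi (Nat.add_le_add_right hsu _)
      · exact (even_sum_selDegree_iff _ I hp').2 hI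
      · exact lt_of_lt_of_le hj (Nat.add_le_add_right hsv _)
    have hbase : (∀ e ∈ H.edgesWithin S, H.inc e = S) → ∀ i, ∃ p,
        H.IsPieceSelection (C i) p ∧ (Odd (selDegree (C i).edges p u) ↔ i ∈ I) := by
      intro hB i
      have hm := even_card_edgesWithin heven hB
      by_cases hi : i ∈ I
      · obtain ⟨-, p, hp, hu, -⟩ := h1 i hi
        exact ⟨p, hp, by grind⟩
      · rcases h2 i hi with ⟨p, hp, hu, -⟩ | ⟨-, p, hp, ⟨hu, -⟩, -⟩ | ⟨-, p, hp, hu, -⟩ |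
          ⟨-, p, hp, -, hu, -⟩ <;> exact ⟨p, hp, by grind⟩
    rcases I.eq_empty_or_nonempty with rfl | ⟨i, hi⟩
    · rcases h3 rfl with ⟨i, hB, p, hp, ⟨hue, hu⟩, -, hv⟩ |
        ⟨i, j, hij, ⟨hBu, p, hp, hpu, hpv, hv0⟩, hBv, q, hq, hqv, hqu, hu0⟩
      · have hm := even_card_edgesWithin heven hB
        choose r hr using hbase hB
        -- The default selections `r` may miss `u` or `v`, so on component `i` the one supplied by
        -- (a) replaces them.
        refine ⟨hB, hfin hB (Function.update r i p) (fun j => ?_) ⟨i, by simpa using hu⟩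
          ⟨i, by simpa using hv⟩⟩
        by_cases hji : j = i
        · subst hji
          simp only [Function.update_self]
          exact ⟨hp, by grind⟩
        · simpa [hji] using hr j
      · have hB0 : ∀ e, e ∉ H.edgesWithin S := fun e he =>
          huv (Finset.singleton_injective ((hBu e he).symm.trans (hBv e he)))
        have hB : ∀ e ∈ H.edgesWithin S, H.inc e = S := fun e he => absurd he (hB0 e)
        choose r hr using hbase hB
        refine ⟨hB, hfin hB (Function.update (Function.update r j q) i p) (fun l => ?_)
          ⟨j, by simp [hij.symm]; omega⟩ ⟨i, by simp; omega⟩⟩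
        by_cases hli : l = i
        · subst hli
          simp only [Function.update_self]
          exact ⟨hp, by grind⟩
        · by_cases hlj : l = j
          · subst hlj
            simp only [Function.update_of_ne hli, Function.update_self]
            exact ⟨hq, by grind⟩
          · simpa [hli, hlj] using hr l
    · obtain ⟨hB, -⟩ := h1 i hi
      choose r hr using hbase hB
      -- A component in `I` has odd, hence positive, degree at both cut vertices.
      have hodd := (hr i).2.2 hi
      have hodd' : Odd (selDegree (C i).edges (r i) v) := by
        rw [← Nat.not_even_iff_odd, ← hpar i _ (hr i).1, Nat.not_even_iff_odd]
        exact hodd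
      exact ⟨hB, hfin hB r hr ⟨i, Nat.add_pos_left hodd.pos _⟩ ⟨i, Nat.add_pos_left hodd'.pos _⟩⟩
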